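/- **Theorem (Arbitrary distillation of quantum learnability).** Let $\mathcal H$ be a finite-dimensional Hilbert space, $M\ge 1$, let $A_1,\dots,A_M$ be Hermitian operators on $\mathcal H$, $|\psi_0\rangle$ a unit vector, and for $\theta\in\mathbb R^M$ put $U(\theta)=e^{i\theta_M A_M}\cdots e^{i\theta_1A_1}$, $|\psi_\theta\rangle=U(\theta)|\psi_0\rangle$, $\rho_\theta=|\psi_\theta\rangle\langle\psi_\theta|$. For a family of pure states, the (symmetric-logarithmic-derivative) quantum Fisher information matrix (QFIM) is $$\mathcal I_{i,j}(\theta|\psi_\theta)=4\,\mathrm{Re}\left[\langle\partial_i\psi_\theta|\partial_j\psi_\theta\rangle-\langle\partial_i\psi_\theta|\psi_\theta\rangle\langle\psi_\theta|\partial_j\psi_\theta\rangle\right].$$ For a positive semidefinite real weight matrix $W$ and a number $N\ge1$ of trials let $$s^{(\mathrm{MI})}(\psi_\theta,W)=\frac1N\inf_{\mathcal M}\mathrm{Tr}\left[W I^{-1}(\theta)\right],$$ where $\mathcal M$ runs over all measurements (POVMs) with finitely many outcomes and $I(\theta)$ is the classical Fisher information matrix of the outcome distribution $p(k|\theta)$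 of $\mathcal M$ in the state $\psi_\theta$ (the trace is read as $+\infty$ if $I(\theta)$ is singular). Fix the true value $\theta$. For an initial estimate $\theta^0\in\mathbb R^M$ put $\delta=\max_m|\theta_m-\theta^0_m|$ and, for $0\le t\le1$, let $K=(t-1)\rho_{\theta^0}+1$ and $F=K^\dagger K$, let $p^{\mathrm{ps}}=\mathrm{Tr}(F\rho_\theta)$ be the success probability, and let $|\psi^{\mathrm{ps}}_\theta\rangle=K|\psi_\theta\rangle/\sqrt{p^{\mathrm{ps}}}$ be the distilled state ($\theta^0$ and $K$ are held fixed when differentiating in $\theta$). Then $0\le F\le 1$, so $\{F,1-F\}$ is a measurement, and: 1. There is a constant $C$, independent of $t$ and $\theta^0$, such that $|p^{\mathrm{ps}}-t^2|\le C\delta^2$ for all $0\le t\le 1$; and for all $0<t\le1$ and all $i,j$, $p^{\mathrm{ps}}>0$, $$\left|\mathcal I_{i,j}(\theta|\psi^{\mathrm{ps}}_\theta)-\frac{\mathcal I_{i,j}(\theta|\psi_\theta)}{t^2}\right|\le \frac{C\delta^2}{t^4},\qquad \left|p^{\mathrm{ps}}\,\mathcal I_{i,j}(\theta|\psi^{\mathrm{ps}}_\theta)-\mathcal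 I_{i,j}(\theta|\psi_\theta)\right|\le\frac{C\delta^2}{t^2}.$$ In particular, for each fixed $t\in(0,1]$, $\mathcal I(\theta|\psi^{\mathrm{ps}}_\theta)=\mathcal I(\theta|\psi_\theta)/t^2+O(\delta^2)$, $p^{\mathrm{ps}}=t^2+O(\delta^2)$, and the distillation is lossless: $p^{\mathrm{ps}}\,\mathcal I(\theta|\psi^{\mathrm{ps}}_\theta)=\mathcal I(\theta|\psi_\theta)+O(\delta^2)$. 2. Let $t\to0^+$ and let $\theta^0$ vary with $t$ such that $M\delta^2/t^2\to0$. Then $p^{\mathrm{ps}}\,\mathcal I(\theta|\psi^{\mathrm{ps}}_\theta)\to\mathcal I(\theta|\psi_\theta)$, and $|\mathcal I_{i,j}(\theta|\psi^{\mathrm{ps}}_\theta)|\to\infty$ whenever $\mathcal I_{i,j}(\theta|\psi_\theta)\ne0$. If $\mathcal I(\theta|\psi_\theta)$ is nonsingular, then moreover $\mathcal I(\theta|\psi^{\mathrm{ps}}_\theta)\to\infty$, that is, for every real $B$ eventually $\mathcal I(\theta|\psi^{\mathrm{ps}}_\theta)\ge B\cdot 1$ as a matrix inequality, and $\det\mathcal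 I(\theta|\psi^{\mathrm{ps}}_\theta)\to\infty$; and $s^{(\mathrm{MI})}(\psi^{\mathrm{ps}}_\theta,W)\to0$ for all $N\ge 1$ and all positive semidefinite $W$. -/

import Mathlib

open Filter Topology
open scoped ENNReal

noncomputable section

namespace QLearn

variable {H : Type*} [NormedAddCommGroup H] [InnerProductSpace ℂ H] [CompleteSpace H] {M : ℕ}

/-- The partial derivative `∂ᵢ f` at `θ`. -/
def partialDeriv {E : Type*} [NormedAddCommGroup E] [NormedSpace ℝ E]
    (i : Fin M) (f : (Fin M → ℝ) → E) (θ : Fin M → ℝ) : E :=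
  deriv (fun s : ℝ => f (Function.update θ i s)) (θ i)

/-- The unitary `U(θ) = U_M(θ_M) ⋯ U_1(θ_1)` with `U_m(θ_m) = exp(i θ_m A_m)`. The factor with the
smallest index acts first. -/
def encU (A : Fin M → H →L[ℂ] H) (θ : Fin M → ℝ) : H →L[ℂ] H :=
  (List.ofFn fun m => NormedSpace.exp ((Complex.I * (θ m : ℂ)) • A m)).reverse.prod

/-- The encoded state vector `|ψ_θ⟩ = U(θ)|ψ₀⟩`. -/
def encState (A : Fin M → H →L[ℂ] H) (ψ₀ : H) (θ : Fin M → ℝ) : H := encU A θ ψ₀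

/-- The encoded density operator `ρ_θ = U(θ) ρ₀ U(θ)†`, with `ρ₀ = |ψ₀⟩⟨ψ₀|`. -/
def encRho (A : Fin M → H →L[ℂ] H) (ψ₀ : H) (θ : Fin M → ℝ) : H →L[ℂ] H :=
  encU A θ * InnerProductSpace.rankOne ℂ ψ₀ ψ₀ * ContinuousLinearMap.adjoint (encU A θ)

/-- The quantum Fisher information matrix (symmetric logarithmic derivative) of a family of
normalized pure states `θ ↦ |ψ_θ⟩`:
`4 Re [⟨∂ᵢψ|∂ⱼψ⟩ - ⟨∂ᵢψ|ψ⟩⟨ψ|∂ⱼψ⟩]`. -/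
def qfim (ψ : (Fin M → ℝ) → H) (θ : Fin M → ℝ) : Matrix (Fin M) (Fin M) ℝ :=
  Matrix.of fun i j =>
    4 * (inner ℂ (partialDeriv i ψ θ) (partialDeriv j ψ θ)
      - inner ℂ (partialDeriv i ψ θ) (ψ θ) * inner ℂ (ψ θ) (partialDeriv j ψ θ)).re

/-- The postselection operator `F = K†K` of a Kraus operator `K`. -/
def postF (K : H →L[ℂ] H) : H →L[ℂ] H := ContinuousLinearMap.adjoint K * K

/-- The success probability `Tr(F ρ_θ)` of the postselection. -/
def postProb (K : H →L[ℂ] H) (A : Fin M → H →L[ℂ] H) (ψ₀ : H) (θ : Fin M → ℝ) : ℝ :=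
  (LinearMap.trace ℂ H (postF K * encRho A ψ₀ θ : H →L[ℂ] H)).re

/-- The postselected (distilled) state vector `K|ψ_θ⟩ / √(p_θ)`. -/
def postState (K : H →L[ℂ] H) (A : Fin M → H →L[ℂ] H) (ψ₀ : H) (θ : Fin M → ℝ) : H :=
  (((Real.sqrt (postProb K A ψ₀ θ))⁻¹ : ℝ) : ℂ) • K (encState A ψ₀ θ)

/-- The distilling Kraus operator `K = (t - 1) ρ_{θ⁰} + 1`. -/
def distK (A : Fin M → H →L[ℂ] H) (ψ₀ : H) (θ₀ : Fin M → ℝ) (t : ℝ) : H →L[ℂ] H :=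
  ((t - 1 : ℝ) : ℂ) • encRho A ψ₀ θ₀ + 1

/-- The success probability, at the true parameter `θ`, of the distillation built from the
estimate `θ₀`. -/
def distProb (A : Fin M → H →L[ℂ] H) (ψ₀ : H) (θ₀ : Fin M → ℝ) (t : ℝ) (θ : Fin M → ℝ) : ℝ :=
  postProb (distK A ψ₀ θ₀ t) A ψ₀ θ

/-- The family of distilled states; the estimate `θ₀`, hence `K`, does not vary with `θ`. -/
def distState (A : Fin M → H →L[ℂ] H) (ψ₀ : H) (θ₀ : Fin M → ℝ) (t : ℝ) (θ : Fin M → ℝ) : H :=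
  postState (distK A ψ₀ θ₀ t) A ψ₀ θ

/-- A quantum measurement (POVM) with `n` outcomes on `H`. -/
structure Measurement (H : Type*) [NormedAddCommGroup H] [InnerProductSpace ℂ H]
    [CompleteSpace H] (n : ℕ) where
  /-- the effects -/
  effect : Fin n → H →L[ℂ] H
  isPositive : ∀ k, (effect k).IsPositive
  sum_eq_one : ∑ k, effect k = 1

/-- Born's rule: the probability `p(k|θ) = ⟨ψ_θ|E_k|ψ_θ⟩`. -/
def outcomeProb {n : ℕ} (E : Measurement H n) (ψ : (Fin M → ℝ) → H) (k : Fin n)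
    (θ : Fin M → ℝ) : ℝ :=
  (inner ℂ (ψ θ) (E.effect k (ψ θ))).re

/-- The classical Fisher information matrix of the outcomes of `E`:
`∑ₖ p(k|θ) (∂ᵢ log p(k|θ)) (∂ⱼ log p(k|θ))`. Outcomes of probability zero contribute zero. -/
def fisher {n : ℕ} (E : Measurement H n) (ψ : (Fin M → ℝ) → H) (θ : Fin M → ℝ) :
    Matrix (Fin M) (Fin M) ℝ :=
  Matrix.of fun i j => ∑ k, outcomeProb E ψ k θ
    * partialDeriv i (fun η => Real.log (outcomeProb E ψ k η)) θ
    * partialDeriv j (fun η => Real.log (outcomeProb E ψ k η)) θ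

open Classical in
/-- The scalar risk `Tr(W I⁻¹) / N` of a Fisher information matrix `I`, after `N` trials; it is
infinite if `I` is singular. -/
def scalarRisk (N : ℕ) (I W : Matrix (Fin M) (Fin M) ℝ) : ℝ≥0∞ :=
  if I.det = 0 then ⊤ else ENNReal.ofReal ((W * I⁻¹).trace / N)

/-- The scalar risk of the most informative measurement, optimized over all measurements with
finitely many outcomes. -/
def riskMI (N : ℕ) (ψ : (Fin M → ℝ) → H) (θ : Fin M → ℝ) (W : Matrix (Fin M) (Fin M) ℝ) : ℝ≥0∞ :=
  ⨅ (n : ℕ) (E : Measurement H n), scalarRisk N (fisher E ψ θ) W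

end QLearn

end

namespace QLearn

variable {G H : Type*} [NormedAddCommGroup G] [InnerProductSpace ℂ G]
  [NormedAddCommGroup H] [InnerProductSpace ℂ H] [CompleteSpace H] {M : ℕ}

/-! ### The encoded family -/

/-! Write `v = ψ_θ`, `φ = ψ_{θ⁰}`, and let `xᵢ` be the part of `∂ᵢψ_θ` orthogonal to `v`. The QFIM
is `4 Re ⟨xᵢ|xⱼ⟩` (`qfim_apply_perp`), and `K` scales `φ` by `t` while fixing `φ^⊥`. As `v` is close
to `φ`, the success probability `p` is about `t²`, whereas `K` hardly shrinks the `xᵢ`;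
renormalizing by `1/√p` then amplifies them. Exactly, the distilled QFIM is the original one over
`p`, minus `4 (1 - t²)/p² · Re ⟨xᵢ|φ⟩⟨φ|xⱼ⟩` (`qfim_distState`). Since `xᵢ ⊥ v`, each overlap
`⟨xᵢ|φ⟩ = ⟨xᵢ|φ - v⟩` is `O(δ)`, so the correction is of second order. Together with `t² ≤ p ≤ t² +
O(δ²)` this gives the error bounds (`exists_distillation_bounds`), and the divergences follow by
dividing the convergent `p 𝓘` by `p → 0`. For the risk, the QFIM need not be attained by a
measurement, but a fixed fraction of it is (`exists_fisher_eq_smul_qfim`): a random choice among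
binary observables has Fisher matrix `QFIM / (4 dim_ℝ H)`. The fraction does not depend on `t`, so
the risk is `O(p)`. -/

lemma encU_zero (A : Fin 0 → H →L[ℂ] H) (θ : Fin 0 → ℝ) : encU A θ = 1 := by
  simp [encU]

lemma encU_succ {n : ℕ} (A : Fin (n + 1) → H →L[ℂ] H) (θ : Fin (n + 1) → ℝ) :
    encU A θ = encU (fun m => A m.succ) (fun m => θ m.succ) *
      NormedSpace.exp ((Complex.I * (θ 0 : ℂ)) • A 0) := by
  simp [encU, List.ofFn_succ]

lemma differentiable_exp_phase (B : H →L[ℂ] H) :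
    Differentiable ℝ fun s : ℝ => NormedSpace.exp ((Complex.I * (s : ℂ)) • B) := by
  intro s
  have h := (hasDerivAt_exp_smul_const (𝕂 := ℂ) B (Complex.I * (s : ℂ)))
  have h2 : HasDerivAt (fun s : ℝ => Complex.I * (s : ℂ)) (Complex.I * 1) s :=
    (Complex.ofRealCLM.hasDerivAt (x := s)).const_mul Complex.I
  exact (h.scomp s h2).differentiableAt

lemma exp_phase_mem_unitary {B : H →L[ℂ] H} (hB : IsSelfAdjoint B) (s : ℝ) :
    NormedSpace.exp ((Complex.I * (s : ℂ)) • B) ∈ unitary (H →L[ℂ] H) := by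
  let +nondep : NormedAlgebra ℚ (H →L[ℂ] H) := .restrictScalars ℚ ℂ _
  apply NormedSpace.exp_mem_unitary_of_mem_skewAdjoint
  rw [skewAdjoint.mem_iff, star_smul, hB.star_eq]
  simp

lemma differentiable_encU : ∀ {n : ℕ} (A : Fin n → H →L[ℂ] H), Differentiable ℝ (encU A)
  | 0, A => by
    have : encU A = fun _ => 1 := funext fun θ => encU_zero A θ
    rw [this]
    exact differentiable_const _
  | n + 1, A => by
    rw [show encU A = _ from funext fun θ => encU_succ A θ]
    refine Differentiable.mul ?_ ?_
    · exact (differentiable_encU fun m : Fin n => A m.succ).comp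
        (differentiable_pi.2 fun m => differentiable_apply _)
    · exact (differentiable_exp_phase (A 0)).comp (differentiable_apply _)

lemma encU_mem_unitary : ∀ {n : ℕ} {A : Fin n → H →L[ℂ] H}, (∀ m, IsSelfAdjoint (A m)) →
    ∀ θ, encU A θ ∈ unitary (H →L[ℂ] H)
  | 0, A, _, θ => by rw [encU_zero]; exact one_mem _
  | n + 1, A, hA, θ => by
    rw [encU_succ]
    exact mul_mem (encU_mem_unitary (fun m => hA m.succ) _) (exp_phase_mem_unitary (hA 0) _)

lemma differentiable_encState (A : Fin M → H →L[ℂ] H) (ψ₀ : H) :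
    Differentiable ℝ (encState A ψ₀) := fun θ =>
  ((ContinuousLinearMap.apply ℂ H ψ₀).restrictScalars ℝ).differentiableAt.comp θ
    (differentiable_encU A θ)

lemma norm_encState {A : Fin M → H →L[ℂ] H} (hA : ∀ m, IsSelfAdjoint (A m)) (ψ₀ : H)
    (θ : Fin M → ℝ) : ‖encState A ψ₀ θ‖ = ‖ψ₀‖ :=
  ContinuousLinearMap.norm_map_of_mem_unitary (encU_mem_unitary hA θ) ψ₀

lemma encRho_eq_rankOne (A : Fin M → H →L[ℂ] H) (ψ₀ : H) (θ : Fin M → ℝ) :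
    encRho A ψ₀ θ = InnerProductSpace.rankOne ℂ (encState A ψ₀ θ) (encState A ψ₀ θ) := by
  ext x
  simp [encRho, encState, ContinuousLinearMap.adjoint_inner_right]

/-- Differentiability gives the bound near `θ`; far away, unit vectors differ by at most 2, whence
the constant `2 / r`. The norm on parameters is the sup norm, so `‖θ - θ₀‖` is `δ`. -/
lemma exists_norm_encState_sub_le {A : Fin M → H →L[ℂ] H} (hA : ∀ m, IsSelfAdjoint (A m))
    {ψ₀ : H} (hψ₀ : ‖ψ₀‖ = 1) (θ : Fin M → ℝ) :
    ∃ L : ℝ, ∀ θ₀, ‖encState A ψ₀ θ₀ - encState A ψ₀ θ‖ ≤ L * ‖θ - θ₀‖ := by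
  obtain ⟨c, hc⟩ := (differentiable_encState A ψ₀ θ).isBigO_sub.bound
  obtain ⟨r, hr, hball⟩ := Metric.eventually_nhds_iff.1 hc
  refine ⟨max c (2 / r), fun θ₀ => ?_⟩
  by_cases h : dist θ₀ θ < r
  · refine (hball h).trans ?_
    rw [norm_sub_rev θ]
    gcongr
    exact le_max_left _ _
  · rw [dist_eq_norm, norm_sub_rev, not_lt] at h
    calc _ ≤ ‖encState A ψ₀ θ₀‖ + ‖encState A ψ₀ θ‖ := norm_sub_le _ _
      _ = 2 / r * r := by rw [norm_encState hA, norm_encState hA, hψ₀]; field_simp; norm_num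
      _ ≤ _ := by gcongr; exact le_max_right _ _

/-! ### The distilling operator -/

lemma distK_apply (A : Fin M → H →L[ℂ] H) (ψ₀ : H) (θ₀ : Fin M → ℝ) (t : ℝ) (x : H) :
    distK A ψ₀ θ₀ t x =
      x - ((1 - t : ℝ) : ℂ) • inner ℂ (encState A ψ₀ θ₀) x • encState A ψ₀ θ₀ := by
  simp only [distK, encRho_eq_rankOne, _root_.add_apply,
    _root_.smul_apply, InnerProductSpace.rankOne_apply,
    one_apply_eq_self]
  push_cast
  module

/-- This is `K†K = 1 - (1 - t²)|φ⟩⟨φ|`: the eigenvalue of `K` at `φ` is `t`. -/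
lemma inner_distK_distK {A : Fin M → H →L[ℂ] H} (hA : ∀ m, IsSelfAdjoint (A m))
    {ψ₀ : H} (hψ₀ : ‖ψ₀‖ = 1) (θ₀ : Fin M → ℝ) (t : ℝ) (x y : H) :
    inner ℂ (distK A ψ₀ θ₀ t x) (distK A ψ₀ θ₀ t y) = inner ℂ x y -
      ((1 - t ^ 2 : ℝ) : ℂ) * (inner ℂ x (encState A ψ₀ θ₀) * inner ℂ (encState A ψ₀ θ₀) y) := by
  have h1 : inner ℂ (encState A ψ₀ θ₀) (encState A ψ₀ θ₀) = (1 : ℂ) := by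
    rw [inner_self_eq_norm_sq_to_K, norm_encState hA, hψ₀]; simp
  simp only [distK_apply, inner_sub_left, inner_sub_right, inner_smul_left, inner_smul_right, h1,
    Complex.conj_ofReal, inner_conj_symm]
  push_cast
  ring

lemma norm_distK_sq {A : Fin M → H →L[ℂ] H} (hA : ∀ m, IsSelfAdjoint (A m))
    {ψ₀ : H} (hψ₀ : ‖ψ₀‖ = 1) (θ₀ : Fin M → ℝ) (t : ℝ) (x : H) :
    ‖distK A ψ₀ θ₀ t x‖ ^ 2 =
      ‖x‖ ^ 2 - (1 - t ^ 2) * ‖inner ℂ (encState A ψ₀ θ₀) x‖ ^ 2 := by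
  have h := inner_distK_distK hA hψ₀ θ₀ t x x
  rw [← inner_conj_symm x (encState A ψ₀ θ₀), Complex.conj_mul',
    inner_self_eq_norm_sq_to_K, inner_self_eq_norm_sq_to_K] at h
  apply Complex.ofReal_injective
  push_cast at h ⊢
  exact h

lemma isPositive_postF (K : H →L[ℂ] H) : (postF K).IsPositive :=
  ContinuousLinearMap.isPositive_adjoint_comp_self K

lemma isPositive_one_sub_postF {K : H →L[ℂ] H} (hK : ∀ x, ‖K x‖ ≤ ‖x‖) :
    (1 - postF K).IsPositive := by
  rw [ContinuousLinearMap.isPositive_def']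
  refine ⟨(IsSelfAdjoint.one _).sub (isPositive_postF K).isSelfAdjoint, fun x => ?_⟩
  have h : inner ℂ ((1 - postF K) x) x = ((‖x‖ ^ 2 - ‖K x‖ ^ 2 : ℝ) : ℂ) := by
    simp [postF, ContinuousLinearMap.adjoint_inner_left,
      inner_self_eq_norm_sq_to_K]
  rw [ContinuousLinearMap.reApplyInnerSelf_apply, h]
  simp only [RCLike.re_to_complex, Complex.ofReal_re, sub_nonneg]
  gcongr
  exact hK x

lemma norm_distK_le {A : Fin M → H →L[ℂ] H} (hA : ∀ m, IsSelfAdjoint (A m))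
    {ψ₀ : H} (hψ₀ : ‖ψ₀‖ = 1) (θ₀ : Fin M → ℝ) {t : ℝ} (ht : t ∈ Set.Icc (0 : ℝ) 1) (x : H) :
    ‖distK A ψ₀ θ₀ t x‖ ≤ ‖x‖ := by
  have h := norm_distK_sq hA hψ₀ θ₀ t x
  have h1 : 0 ≤ 1 - t ^ 2 := by nlinarith [ht.1, ht.2]
  refine (sq_le_sq₀ (norm_nonneg _) (norm_nonneg _)).1 ?_
  rw [h]
  nlinarith [mul_nonneg h1 (sq_nonneg ‖inner ℂ (encState A ψ₀ θ₀) x‖)]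

lemma postProb_eq [FiniteDimensional ℂ H] (K : H →L[ℂ] H) (A : Fin M → H →L[ℂ] H) (ψ₀ : H)
    (θ : Fin M → ℝ) : postProb K A ψ₀ θ = ‖K (encState A ψ₀ θ)‖ ^ 2 := by
  rw [postProb, encRho_eq_rankOne, ContinuousLinearMap.mul_def, InnerProductSpace.comp_rankOne,
    InnerProductSpace.trace_rankOne, postF, ContinuousLinearMap.mul_def,
    ContinuousLinearMap.comp_apply,
    ContinuousLinearMap.adjoint_inner_right, inner_self_eq_norm_sq_to_K]
  norm_cast

lemma distProb_eq [FiniteDimensional ℂ H] {A : Fin M → H →L[ℂ] H}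
    (hA : ∀ m, IsSelfAdjoint (A m)) {ψ₀ : H} (hψ₀ : ‖ψ₀‖ = 1) (θ₀ : Fin M → ℝ) (t : ℝ)
    (θ : Fin M → ℝ) : distProb A ψ₀ θ₀ t θ =
      1 - (1 - t ^ 2) * ‖inner ℂ (encState A ψ₀ θ₀) (encState A ψ₀ θ)‖ ^ 2 := by
  rw [distProb, postProb_eq, norm_distK_sq hA hψ₀, norm_encState hA, hψ₀, one_pow]

/-- The infidelity of two unit vectors is at most their squared distance. -/
lemma one_sub_norm_inner_sq_le {u v : G} (hu : ‖u‖ = 1) (hv : ‖v‖ = 1) :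
    1 - ‖inner ℂ u v‖ ^ 2 ≤ ‖u - v‖ ^ 2 := by
  have h1 : ‖inner ℂ u v‖ ≤ 1 := by simpa [hu, hv] using norm_inner_le_norm (𝕜 := ℂ) u v
  have h2 := norm_sub_sq (𝕜 := ℂ) u v
  have h3 : RCLike.re (inner ℂ u v) ≤ ‖inner ℂ u v‖ := RCLike.re_le_norm _
  rw [h2, hu, hv]
  -- With `a` the modulus of the overlap, `1 - a² = (1 - a)(1 + a) ≤ 2 (1 - a)`.
  nlinarith [norm_nonneg (inner ℂ u v)]

/-- With `c` the fidelity of the two states, `p - t² = (1 - t²)(1 - c)`. This bounds every later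
denominator without assuming `δ` small. -/
lemma sq_le_distProb [FiniteDimensional ℂ H] {A : Fin M → H →L[ℂ] H}
    (hA : ∀ m, IsSelfAdjoint (A m)) {ψ₀ : H} (hψ₀ : ‖ψ₀‖ = 1) (θ₀ : Fin M → ℝ) {t : ℝ}
    (ht : t ∈ Set.Icc (0 : ℝ) 1) (θ : Fin M → ℝ) : t ^ 2 ≤ distProb A ψ₀ θ₀ t θ := by
  rw [distProb_eq hA hψ₀]
  have h1 : ‖inner ℂ (encState A ψ₀ θ₀) (encState A ψ₀ θ)‖ ≤ 1 := by
    simpa [norm_encState hA, hψ₀] using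
      norm_inner_le_norm (𝕜 := ℂ) (encState A ψ₀ θ₀) (encState A ψ₀ θ)
  have h2 : ‖inner ℂ (encState A ψ₀ θ₀) (encState A ψ₀ θ)‖ ^ 2 ≤ 1 :=
    pow_le_one₀ (norm_nonneg _) h1
  have h3 : 0 ≤ 1 - t ^ 2 := by nlinarith [ht.1, ht.2]
  nlinarith [mul_le_mul_of_nonneg_left h2 h3]

lemma distProb_sub_sq_le [FiniteDimensional ℂ H] {A : Fin M → H →L[ℂ] H}
    (hA : ∀ m, IsSelfAdjoint (A m)) {ψ₀ : H} (hψ₀ : ‖ψ₀‖ = 1) (θ₀ : Fin M → ℝ) (t : ℝ)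
    (θ : Fin M → ℝ) : distProb A ψ₀ θ₀ t θ - t ^ 2 ≤
      ‖encState A ψ₀ θ₀ - encState A ψ₀ θ‖ ^ 2 := by
  have h1 : ‖inner ℂ (encState A ψ₀ θ₀) (encState A ψ₀ θ)‖ ≤ 1 := by
    simpa [norm_encState hA, hψ₀] using
      norm_inner_le_norm (𝕜 := ℂ) (encState A ψ₀ θ₀) (encState A ψ₀ θ)
  have h2 : ‖inner ℂ (encState A ψ₀ θ₀) (encState A ψ₀ θ)‖ ^ 2 ≤ 1 :=
    pow_le_one₀ (norm_nonneg _) h1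
  have h3 := one_sub_norm_inner_sq_le (u := encState A ψ₀ θ₀) (v := encState A ψ₀ θ)
    (by rw [norm_encState hA, hψ₀]) (by rw [norm_encState hA, hψ₀])
  rw [distProb_eq hA hψ₀]
  nlinarith [mul_nonneg (sq_nonneg t) (sub_nonneg.2 h2)]

/-! ### The quantum Fisher information matrix -/

/-- The component of `x` orthogonal to the unit vector `u`. -/
noncomputable def perp (u x : G) : G := x - inner ℂ u x • u

lemma inner_perp_right {u : G} (hu : ‖u‖ = 1) (x : G) : inner ℂ u (perp u x) = 0 := by
  rw [perp, inner_sub_right, inner_smul_right, inner_self_eq_norm_sq_to_K, hu]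
  simp

lemma inner_perp_left {u : G} (hu : ‖u‖ = 1) (x : G) : inner ℂ (perp u x) u = 0 := by
  rw [← inner_conj_symm, inner_perp_right hu, map_zero]

/-- Adding multiples of `u` to `x` and `y` does not change the covariance. -/
lemma covariance_add_smul {u : G} (hu : ‖u‖ = 1) (a b : ℂ) (x y : G) :
    inner ℂ (a • u + x) (b • u + y) - inner ℂ (a • u + x) u * inner ℂ u (b • u + y) =
      inner ℂ x y - inner ℂ x u * inner ℂ u y := by
  have h1 : inner ℂ u u = (1 : ℂ) := by simp [inner_self_eq_norm_sq_to_K, hu]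
  simp only [inner_add_left, inner_add_right, inner_smul_left, inner_smul_right, h1]
  ring

/-- The covariance ignores multiples of the state; once they are removed, its product term vanishes
and a Gram matrix remains. -/
lemma qfim_apply_perp {ψ : (Fin M → ℝ) → G} {θ : Fin M → ℝ} (h : ‖ψ θ‖ = 1) (i j : Fin M) :
    qfim ψ θ i j = 4 * (inner ℂ (perp (ψ θ) (partialDeriv i ψ θ))
      (perp (ψ θ) (partialDeriv j ψ θ))).re := by
  have e : ∀ x : G, x = inner ℂ (ψ θ) x • ψ θ + perp (ψ θ) x := fun x => by simp [perp]
  have := covariance_add_smul h (inner ℂ (ψ θ) (partialDeriv i ψ θ))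
    (inner ℂ (ψ θ) (partialDeriv j ψ θ)) (perp (ψ θ) (partialDeriv i ψ θ))
    (perp (ψ θ) (partialDeriv j ψ θ))
  rw [← e, ← e, inner_perp_right h, mul_zero, sub_zero] at this
  rw [qfim, Matrix.of_apply, this]

lemma hasDerivAt_partialDeriv {E : Type*} [NormedAddCommGroup E] [NormedSpace ℝ E]
    {f : (Fin M → ℝ) → E} {θ : Fin M → ℝ} (hf : DifferentiableAt ℝ f θ) (i : Fin M) :
    HasDerivAt (fun s : ℝ => f (Function.update θ i s)) (partialDeriv i f θ) (θ i) := by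
  refine DifferentiableAt.hasDerivAt ?_
  have h : HasDerivAt (Function.update θ i) _ (θ i) := hasDerivAt_update θ i (θ i)
  refine DifferentiableAt.comp (θ i) ?_ h.differentiableAt
  rwa [Function.update_eq_self]

lemma distState_eq [FiniteDimensional ℂ H] (A : Fin M → H →L[ℂ] H) (ψ₀ : H) (θ₀ : Fin M → ℝ)
    (t : ℝ) (θ : Fin M → ℝ) : distState A ψ₀ θ₀ t θ =
      ((Real.sqrt (distProb A ψ₀ θ₀ t θ))⁻¹ : ℝ) • distK A ψ₀ θ₀ t (encState A ψ₀ θ) := by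
  rw [distState, postState, Complex.coe_smul, distProb]

lemma norm_distState [FiniteDimensional ℂ H] {A : Fin M → H →L[ℂ] H}
    (hA : ∀ m, IsSelfAdjoint (A m)) {ψ₀ : H} (hψ₀ : ‖ψ₀‖ = 1) (θ₀ : Fin M → ℝ) {t : ℝ}
    (ht : t ∈ Set.Ioc (0 : ℝ) 1) (θ : Fin M → ℝ) : ‖distState A ψ₀ θ₀ t θ‖ = 1 := by
  have hp : 0 < distProb A ψ₀ θ₀ t θ :=
    (pow_pos ht.1 2).trans_le (sq_le_distProb hA hψ₀ θ₀ ⟨ht.1.le, ht.2⟩ θ)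
  rw [distState_eq, norm_smul, distProb, postProb_eq, Real.sqrt_sq (norm_nonneg _), norm_inv,
    norm_norm]
  refine inv_mul_cancel₀ fun h => ?_
  rw [distProb, postProb_eq, h] at hp
  simp at hp

lemma differentiable_distProb [FiniteDimensional ℂ H] (A : Fin M → H →L[ℂ] H) (ψ₀ : H)
    (θ₀ : Fin M → ℝ) (t : ℝ) : Differentiable ℝ (distProb A ψ₀ θ₀ t) := by
  have h : distProb A ψ₀ θ₀ t = fun θ =>
      (inner ℂ (distK A ψ₀ θ₀ t (encState A ψ₀ θ)) (distK A ψ₀ θ₀ t (encState A ψ₀ θ))).re := by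
    funext θ
    rw [distProb, postProb_eq, inner_self_eq_norm_sq_to_K]
    norm_cast
  have h1 : Differentiable ℝ fun θ => distK A ψ₀ θ₀ t (encState A ψ₀ θ) := fun θ =>
    ((distK A ψ₀ θ₀ t).restrictScalars ℝ).differentiableAt.comp θ (differentiable_encState A ψ₀ θ)
  rw [h]
  exact fun θ => Complex.reCLM.differentiableAt.comp θ ((h1.inner ℂ h1) θ)

lemma differentiable_distState [FiniteDimensional ℂ H] {A : Fin M → H →L[ℂ] H}
    (hA : ∀ m, IsSelfAdjoint (A m)) {ψ₀ : H} (hψ₀ : ‖ψ₀‖ = 1) (θ₀ : Fin M → ℝ) {t : ℝ}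
    (ht : t ∈ Set.Ioc (0 : ℝ) 1) : Differentiable ℝ (distState A ψ₀ θ₀ t) := by
  have hp : ∀ θ, 0 < distProb A ψ₀ θ₀ t θ := fun θ =>
    (pow_pos ht.1 2).trans_le (sq_le_distProb hA hψ₀ θ₀ ⟨ht.1.le, ht.2⟩ θ)
  have h1 : Differentiable ℝ fun θ => distK A ψ₀ θ₀ t (encState A ψ₀ θ) := fun θ =>
    ((distK A ψ₀ θ₀ t).restrictScalars ℝ).differentiableAt.comp θ (differentiable_encState A ψ₀ θ)
  rw [show distState A ψ₀ θ₀ t = _ from funext fun θ => distState_eq A ψ₀ θ₀ t θ]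
  exact fun θ => (((differentiable_distProb A ψ₀ θ₀ t θ).sqrt (hp θ).ne').inv
    (Real.sqrt_pos.2 (hp θ)).ne').smul (h1 θ)

/-- The quantum Fisher information matrix of the distilled states, in closed form. -/
lemma qfim_distState [FiniteDimensional ℂ H] {A : Fin M → H →L[ℂ] H}
    (hA : ∀ m, IsSelfAdjoint (A m)) {ψ₀ : H} (hψ₀ : ‖ψ₀‖ = 1) (θ₀ : Fin M → ℝ) {t : ℝ}
    (ht : t ∈ Set.Ioc (0 : ℝ) 1) (θ : Fin M → ℝ) (i j : Fin M) :
    qfim (distState A ψ₀ θ₀ t) θ i j =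
      qfim (encState A ψ₀) θ i j / distProb A ψ₀ θ₀ t θ -
        4 * ((1 - t ^ 2) / distProb A ψ₀ θ₀ t θ ^ 2) *
          (inner ℂ (perp (encState A ψ₀ θ) (partialDeriv i (encState A ψ₀) θ)) (encState A ψ₀ θ₀) *
            inner ℂ (encState A ψ₀ θ₀)
              (perp (encState A ψ₀ θ) (partialDeriv j (encState A ψ₀) θ))).re := by
  have hv : ‖encState A ψ₀ θ‖ = 1 := by rw [norm_encState hA, hψ₀]
  have hp : 0 < distProb A ψ₀ θ₀ t θ :=
    (pow_pos ht.1 2).trans_le (sq_le_distProb hA hψ₀ θ₀ ⟨ht.1.le, ht.2⟩ θ)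
  have hu := norm_distState hA hψ₀ θ₀ ht θ
  have hpe := distProb_eq hA hψ₀ θ₀ t θ
  rw [qfim_apply_perp hv i j]
  set v := encState A ψ₀ θ with hv_def
  set φ := encState A ψ₀ θ₀
  set K := distK A ψ₀ θ₀ t with hK
  set p := distProb A ψ₀ θ₀ t θ
  set s : ℝ := (Real.sqrt p)⁻¹ with hs
  have hs2 : s ^ 2 = 1 / p := by rw [hs, inv_pow, Real.sq_sqrt hp.le, one_div]
  have hs0 : s ≠ 0 := by rw [hs]; exact inv_ne_zero (Real.sqrt_pos.2 hp).ne'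
  have hue : distState A ψ₀ θ₀ t θ = (s : ℂ) • K v := by
    rw [distState_eq, Complex.coe_smul]
  -- the derivatives agree with `s K vᵢ^⊥` up to multiples of the state
  have hder : ∀ k, ∃ a : ℂ, partialDeriv k (distState A ψ₀ θ₀ t) θ =
      a • distState A ψ₀ θ₀ t θ + (s : ℂ) • K (perp v (partialDeriv k (encState A ψ₀) θ)) := by
    intro k
    have h1 := hasDerivAt_partialDeriv (differentiable_encState A ψ₀ θ) k
    have h2 := (K.restrictScalars ℝ).hasFDerivAt.comp_hasDerivAt (θ k) h1
    have h3 := hasDerivAt_partialDeriv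
      (((differentiable_distProb A ψ₀ θ₀ t θ).sqrt hp.ne').inv (Real.sqrt_pos.2 hp).ne') k
    have h4 := h3.smul h2
    have h5 := hasDerivAt_partialDeriv (differentiable_distState hA hψ₀ θ₀ ht θ) k
    have h6 : (fun r : ℝ => distState A ψ₀ θ₀ t (Function.update θ k r)) = _ :=
      funext fun r => distState_eq A ψ₀ θ₀ t (Function.update θ k r)
    rw [h6] at h5
    have h7 := h5.unique h4
    simp only [Function.comp_apply, Function.update_eq_self] at h7
    set b : ℝ := partialDeriv k (fun η => (Real.sqrt (distProb A ψ₀ θ₀ t η))⁻¹) θ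
    -- The product rule gives `s K ∂v + b K v`. Here `K v` is the state over `s`, and the component
    -- of `∂v` along `v` adds `⟨v|∂v⟩` times the state.
    refine ⟨b / s + inner ℂ v (partialDeriv k (encState A ψ₀) θ), ?_⟩
    have hsc : (s : ℂ) ≠ 0 := by exact_mod_cast hs0
    rw [h7, hue, perp]
    simp only [Pi.inv_apply, ContinuousLinearMap.coe_restrictScalars', map_sub, map_smul,
      ← Complex.coe_smul, ← hv_def]
    change (s : ℂ) • K (partialDeriv k (encState A ψ₀) θ) + (b : ℂ) • K v = _
    match_scalars
    · ring
    · field_simp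
      ring
  obtain ⟨a, ha⟩ := hder i
  obtain ⟨b, hb⟩ := hder j
  set x := perp v (partialDeriv i (encState A ψ₀) θ) with hx
  set y := perp v (partialDeriv j (encState A ψ₀) θ) with hy
  have hxv : inner ℂ x v = 0 := inner_perp_left hv _
  have hvy : inner ℂ v y = 0 := inner_perp_right hv _
  have hcc : inner ℂ φ v * inner ℂ v φ = ((‖inner ℂ φ v‖ ^ 2 : ℝ) : ℂ) := by
    rw [← inner_conj_symm v φ, Complex.mul_conj']; norm_cast
  rw [qfim, Matrix.of_apply, ha, hb, covariance_add_smul hu, hue]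
  simp only [inner_smul_left, inner_smul_right, Complex.conj_ofReal]
  rw [hK, inner_distK_distK hA hψ₀, inner_distK_distK hA hψ₀, inner_distK_distK hA hψ₀, hxv, hvy]
  set w := inner ℂ x φ * inner ℂ φ y with hw
  set c := ‖inner ℂ φ v‖ ^ 2
  -- Because `x, y ⊥ v`, both terms of the covariance have corrections proportional to the same `w`.
  have key : (s : ℂ) * (s * (inner ℂ x y - ((1 - t ^ 2 : ℝ) : ℂ) * w)) -
      s * (s * (0 - ((1 - t ^ 2 : ℝ) : ℂ) * (inner ℂ x φ * inner ℂ φ v))) *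
        (s * (s * (0 - ((1 - t ^ 2 : ℝ) : ℂ) * (inner ℂ v φ * inner ℂ φ y)))) =
      ((s ^ 2 : ℝ) : ℂ) * inner ℂ x y -
        ((s ^ 2 * (1 - t ^ 2) + (s ^ 2) ^ 2 * (1 - t ^ 2) ^ 2 * c : ℝ) : ℂ) * w := by
    have hcc' : inner ℂ φ v * inner ℂ v φ = (c : ℂ) := hcc
    push_cast
    rw [← hcc', hw]
    ring
  refine (congrArg (fun z : ℂ => 4 * z.re) key).trans ?_
  simp only [Complex.sub_re, Complex.re_ofReal_mul]
  -- With `q = 1 - t²`, the coefficients of `w` combine to `q/p + q(1 - p)/p² = q/p²`.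
  have hcp : (1 - t ^ 2) * c = 1 - p := by rw [hpe]; ring
  have e1 : s ^ 2 * (1 - t ^ 2) + (s ^ 2) ^ 2 * (1 - t ^ 2) ^ 2 * c = (1 - t ^ 2) / p ^ 2 := by
    have : (s ^ 2) ^ 2 * (1 - t ^ 2) ^ 2 * c = (s ^ 2) ^ 2 * (1 - t ^ 2) * ((1 - t ^ 2) * c) := by
      ring
    rw [this, hcp, hs2]
    field_simp
    ring
  rw [e1, hs2]
  ring

/-! ### A measurement whose Fisher information is proportional to the QFIM -/

lemma inner_perp_comm (u x y : G) : inner ℂ x (perp u y) = inner ℂ (perp u x) y := by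
  simp only [perp, inner_sub_left, inner_sub_right, inner_smul_left, inner_smul_right,
    inner_conj_symm]
  ring

lemma norm_perp_le {u : G} (hu : ‖u‖ = 1) (x : G) : ‖perp u x‖ ≤ ‖x‖ := by
  have h : ‖perp u x‖ * ‖perp u x‖ ≤ ‖perp u x‖ * ‖x‖ := by
    have h1 : inner ℂ (perp u x) (perp u x) = inner ℂ (perp u x) x := by
      conv_lhs => rw [perp.eq_def u x, inner_sub_right, inner_smul_right, ← perp.eq_def,
        inner_perp_left hu, mul_zero, sub_zero]
    rw [← inner_self_eq_norm_mul_norm (𝕜 := ℂ), h1]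
    exact (RCLike.re_le_norm _).trans (norm_inner_le_norm _ _)
  rcases (norm_nonneg (perp u x)).eq_or_lt with h0 | h0
  · rw [← h0]; exact norm_nonneg x
  · exact le_of_mul_le_mul_left h h0

/-- The effect `c (1 + σ (|u⟩⟨e| + |e⟩⟨u|) / 2)`. -/
noncomputable def tiltEffect (c σ : ℝ) (u e : G) : G →L[ℂ] G :=
  (c : ℂ) • (1 + ((σ / 2 : ℝ) : ℂ) •
    (InnerProductSpace.rankOne ℂ u e + InnerProductSpace.rankOne ℂ e u))

lemma inner_tiltEffect (c σ : ℝ) (u e x : G) :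
    inner ℂ x (tiltEffect c σ u e x) =
      ((c * (‖x‖ ^ 2 + σ * (inner ℂ x u * inner ℂ e x).re) : ℝ) : ℂ) := by
  have h : inner ℂ x u * inner ℂ e x + inner ℂ x e * inner ℂ u x =
      ((2 * (inner ℂ x u * inner ℂ e x).re : ℝ) : ℂ) := by
    rw [← Complex.add_conj, map_mul, inner_conj_symm, inner_conj_symm]
    ring
  simp only [tiltEffect, _root_.smul_apply, _root_.add_apply, one_apply_eq_self,
    InnerProductSpace.rankOne_apply, inner_smul_right, inner_add_right,
    inner_self_eq_norm_sq_to_K]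
  rw [mul_comm (inner ℂ e x), mul_comm (inner ℂ u x), h]
  push_cast
  simp only [Complex.coe_algebraMap]
  ring

lemma isPositive_tiltEffect {c σ : ℝ} (hc : 0 ≤ c) (hσ : |σ| ≤ 1) {u e : G} (hu : ‖u‖ = 1)
    (he : ‖e‖ ≤ 1) : (tiltEffect c σ u e).IsPositive := by
  rw [ContinuousLinearMap.isPositive_iff_complex]
  intro x
  rw [← inner_conj_symm, inner_tiltEffect, Complex.conj_ofReal]
  refine ⟨by rw [RCLike.re_to_complex, Complex.ofReal_re], ?_⟩
  have h1 : |(inner ℂ x u * inner ℂ e x).re| ≤ ‖x‖ ^ 2 := by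
    calc _ ≤ ‖inner ℂ x u * inner ℂ e x‖ := Complex.abs_re_le_norm _
      _ = ‖inner ℂ x u‖ * ‖inner ℂ e x‖ := norm_mul _ _
      _ ≤ (‖x‖ * ‖u‖) * (‖e‖ * ‖x‖) := by
        gcongr <;> exact norm_inner_le_norm _ _
      _ ≤ (‖x‖ * 1) * (1 * ‖x‖) := by rw [hu]; gcongr
      _ = ‖x‖ ^ 2 := by ring
  have h2 : |σ * (inner ℂ x u * inner ℂ e x).re| ≤ ‖x‖ ^ 2 := by
    rw [abs_mul]
    calc _ ≤ 1 * |(inner ℂ x u * inner ℂ e x).re| := by gcongr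
      _ ≤ _ := by rw [one_mul]; exact h1
  simp only [RCLike.re_to_complex, Complex.ofReal_re]
  exact mul_nonneg hc (by linarith [(abs_le.1 h2).1])

lemma tiltEffect_add_tiltEffect_neg (c : ℝ) (u e : G) :
    tiltEffect c 1 u e + tiltEffect c (-1) u e = ((2 * c : ℝ) : ℂ) • (1 : G →L[ℂ] G) := by
  simp only [tiltEffect]
  push_cast
  module

/-- With probability `1 / m` each, measure one of the observables `|u⟩⟨e a| + |e a⟩⟨u|` with
binary outcomes. -/
noncomputable def tiltMeasurement {m : ℕ} (hm : m ≠ 0) {u : H} (hu : ‖u‖ = 1) {e : Fin m → H}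
    (he : ∀ a, ‖e a‖ ≤ 1) : Measurement H (m + m) where
  effect := Fin.append (fun a => tiltEffect (2 * m : ℝ)⁻¹ 1 u (e a))
    (fun a => tiltEffect (2 * m : ℝ)⁻¹ (-1) u (e a))
  isPositive k := by
    refine Fin.addCases (fun a => ?_) (fun a => ?_) k
    · rw [Fin.append_left]
      exact isPositive_tiltEffect (by positivity) (by simp) hu (he a)
    · rw [Fin.append_right]
      exact isPositive_tiltEffect (by positivity) (by simp) hu (he a)
  sum_eq_one := by
    have hm' : (m : ℂ) ≠ 0 := Nat.cast_ne_zero.2 hm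
    simp only [Fin.sum_univ_add, Fin.append_left, Fin.append_right]
    rw [← Finset.sum_add_distrib]
    simp only [tiltEffect_add_tiltEffect_neg, Finset.sum_const, Finset.card_univ, Fintype.card_fin]
    rw [← Nat.cast_smul_eq_nsmul ℂ, smul_smul]
    push_cast
    rw [show (m : ℂ) * (2 * (2 * (m : ℂ))⁻¹) = 1 by field_simp, one_smul]

/-- At `θ` the factor `⟨e|ψ⟩` vanishes, so the probability there is `c`, and only the derivative of
that factor survives the product rule. -/
lemma partialDeriv_log_tilt {ψ : (Fin M → ℝ) → G} {θ : Fin M → ℝ} (hψ : ∀ η, ‖ψ η‖ = 1)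
    (hd : DifferentiableAt ℝ ψ θ) {c σ : ℝ} (hc : c ≠ 0) {e : G} (he : inner ℂ e (ψ θ) = 0)
    (i : Fin M) :
    partialDeriv i (fun η => Real.log (c * (‖ψ η‖ ^ 2 +
      σ * (inner ℂ (ψ η) (ψ θ) * inner ℂ e (ψ η)).re))) θ =
      σ * (inner ℂ (partialDeriv i ψ θ) e).re := by
  have h1 := hasDerivAt_partialDeriv hd i
  have h2 := (h1.inner ℂ (hasDerivAt_const (θ i) (ψ θ))).mul
    ((hasDerivAt_const (θ i) e).inner ℂ h1)
  have h3 := Complex.reCLM.hasFDerivAt.comp_hasDerivAt (θ i) h2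
  have h4 := (((h3.const_mul σ).const_add 1).const_mul c).log (by simp [he, hc])
  have h5 : inner ℂ (ψ θ) (ψ θ) = (1 : ℂ) := by simp [inner_self_eq_norm_sq_to_K, hψ]
  simp only [hψ, one_pow]
  refine h4.deriv.trans ?_
  simp only [Pi.mul_apply, Function.comp_apply, Function.update_eq_self, he, h5, inner_zero_left,
    inner_zero_right, zero_add, add_zero, mul_zero, one_mul, Complex.reCLM_apply, Complex.zero_re,
    mul_one]
  rw [mul_div_cancel_left₀ _ hc, ← inner_conj_symm, Complex.conj_re]

/-- At `θ` all outcomes have probability `1 / (2m)`, and the two outcomes of a pair have opposite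
scores, so each pair contributes `1 / m` times a product of scores. -/
lemma fisher_tiltMeasurement {ψ : (Fin M → ℝ) → H} {θ : Fin M → ℝ} (hψ : ∀ η, ‖ψ η‖ = 1)
    (hd : DifferentiableAt ℝ ψ θ) {m : ℕ} (hm : m ≠ 0) {e : Fin m → H} (he : ∀ a, ‖e a‖ ≤ 1)
    (he0 : ∀ a, inner ℂ (e a) (ψ θ) = 0) (i j : Fin M) :
    fisher (tiltMeasurement hm (hψ θ) he) ψ θ i j = (m : ℝ)⁻¹ *
      ∑ a, (inner ℂ (partialDeriv i ψ θ) (e a)).re * (inner ℂ (partialDeriv j ψ θ) (e a)).re := by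
  have hm' : (m : ℝ) ≠ 0 := Nat.cast_ne_zero.2 hm
  have hc : (2 * m : ℝ)⁻¹ ≠ 0 := by positivity
  rw [fisher, Matrix.of_apply, Fin.sum_univ_add]
  simp only [outcomeProb, tiltMeasurement, Fin.append_left, Fin.append_right, inner_tiltEffect,
    Complex.ofReal_re]
  rw [← Finset.sum_add_distrib, Finset.mul_sum]
  refine Finset.sum_congr rfl fun a _ => ?_
  simp only [partialDeriv_log_tilt hψ hd hc (he0 a)]
  simp only [he0 a, hψ, mul_zero, Complex.zero_re]
  field_simp
  ring

lemma exists_fisher_eq_smul_qfim [FiniteDimensional ℂ H] {ψ : (Fin M → ℝ) → H} {θ : Fin M → ℝ}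
    (hψ : ∀ η, ‖ψ η‖ = 1) (hd : DifferentiableAt ℝ ψ θ) :
    ∃ (n : ℕ) (E : Measurement H n),
      fisher E ψ θ = (4 * Module.finrank ℝ H : ℝ)⁻¹ • qfim ψ θ := by
  have hne : ψ θ ≠ 0 := fun h => by simpa [h] using hψ θ
  have : Nontrivial H := nontrivial_of_ne _ _ hne
  have : FiniteDimensional ℝ H := FiniteDimensional.complexToReal H
  have hm : Module.finrank ℝ H ≠ 0 := Module.finrank_pos.ne'
  have hm' : (Module.finrank ℝ H : ℝ) ≠ 0 := Nat.cast_ne_zero.2 hm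
  -- The scores are real parts of inner products, so Parseval needs a basis of `H` as a real space;
  -- a complex basis would miss the imaginary parts of the coordinates.
  let : InnerProductSpace ℝ H := InnerProductSpace.rclikeToReal ℂ H
  let b := stdOrthonormalBasis ℝ H
  have he : ∀ a, ‖perp (ψ θ) (b a)‖ ≤ 1 := fun a =>
    (norm_perp_le (hψ θ) _).trans (b.orthonormal.1 a).le
  refine ⟨_, tiltMeasurement hm (hψ θ) he, ?_⟩
  ext i j
  rw [fisher_tiltMeasurement hψ hd hm he (fun a => inner_perp_left (hψ θ) _), Matrix.smul_apply,
    qfim_apply_perp (hψ θ), smul_eq_mul]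
  have h := b.sum_inner_mul_inner (perp (ψ θ) (partialDeriv i ψ θ))
    (perp (ψ θ) (partialDeriv j ψ θ))
  simp only [inner_perp_comm (ψ θ) _ (b _)]
  rw [real_inner_eq_re_inner ℂ] at h
  simp only [RCLike.re_to_complex] at h
  rw [← h, mul_inv]
  have h2 : ∀ a, inner ℝ (perp (ψ θ) (partialDeriv i ψ θ)) (b a) *
      inner ℝ (b a) (perp (ψ θ) (partialDeriv j ψ θ)) =
      (inner ℂ (perp (ψ θ) (partialDeriv i ψ θ)) (b a)).re *
        (inner ℂ (perp (ψ θ) (partialDeriv j ψ θ)) (b a)).re := fun a => by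
    rw [real_inner_comm (perp (ψ θ) (partialDeriv j ψ θ)), real_inner_eq_re_inner ℂ,
      real_inner_eq_re_inner ℂ]
    rfl
  simp only [h2]
  ring

lemma riskMI_le [FiniteDimensional ℂ H] {ψ : (Fin M → ℝ) → H} {θ : Fin M → ℝ}
    (hψ : ∀ η, ‖ψ η‖ = 1) (hd : DifferentiableAt ℝ ψ θ) (N : ℕ)
    (W : Matrix (Fin M) (Fin M) ℝ) :
    riskMI N ψ θ W ≤ scalarRisk N ((4 * Module.finrank ℝ H : ℝ)⁻¹ • qfim ψ θ) W := by
  obtain ⟨n, E, hE⟩ := exists_fisher_eq_smul_qfim hψ hd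
  rw [← hE]
  exact iInf₂_le n E

/-! ### Error bounds -/

lemma abs_qfim_le {ψ : (Fin M → ℝ) → G} {θ : Fin M → ℝ} (h : ‖ψ θ‖ = 1) {D : ℝ}
    (hD : ∀ k, ‖perp (ψ θ) (partialDeriv k ψ θ)‖ ≤ D) (i j : Fin M) :
    |qfim ψ θ i j| ≤ 4 * D ^ 2 := by
  rw [qfim_apply_perp h, abs_mul, abs_of_pos (by norm_num : (0 : ℝ) < 4)]
  refine mul_le_mul_of_nonneg_left ?_ (by norm_num)
  calc _ ≤ _ := Complex.abs_re_le_norm _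
    _ ≤ _ := norm_inner_le_norm _ _
    _ ≤ D * D := mul_le_mul (hD i) (hD j) (norm_nonneg _) ((norm_nonneg _).trans (hD i))
    _ = D ^ 2 := (sq D).symm

/-- Orthogonality to `v` lets `φ - v` replace `φ` in both factors, each thereby of first order. -/
lemma abs_re_inner_mul_inner_le {v φ x y : G} (hx : inner ℂ x v = 0) (hy : inner ℂ v y = 0)
    {D : ℝ} (hxD : ‖x‖ ≤ D) (hyD : ‖y‖ ≤ D) :
    |(inner ℂ x φ * inner ℂ φ y).re| ≤ D ^ 2 * ‖φ - v‖ ^ 2 := by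
  have h1 : inner ℂ x φ = inner ℂ x (φ - v) := by rw [inner_sub_right, hx, sub_zero]
  have h2 : inner ℂ φ y = inner ℂ (φ - v) y := by rw [inner_sub_left, hy, sub_zero]
  have hD : 0 ≤ D := (norm_nonneg _).trans hxD
  calc _ ≤ ‖inner ℂ x φ * inner ℂ φ y‖ := Complex.abs_re_le_norm _
    _ = ‖inner ℂ x (φ - v)‖ * ‖inner ℂ (φ - v) y‖ := by rw [norm_mul, h1, h2]
    _ ≤ (‖x‖ * ‖φ - v‖) * (‖φ - v‖ * ‖y‖) := by gcongr <;> exact norm_inner_le_norm _ _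
    _ ≤ (D * ‖φ - v‖) * (‖φ - v‖ * D) := by gcongr
    _ = _ := by ring

lemma exists_distillation_bounds [FiniteDimensional ℂ H] {A : Fin M → H →L[ℂ] H}
    (hA : ∀ m, IsSelfAdjoint (A m)) {ψ₀ : H} (hψ₀ : ‖ψ₀‖ = 1) (θ : Fin M → ℝ) :
    ∃ C : ℝ, ∀ θ₀ : Fin M → ℝ,
      (∀ t ∈ Set.Icc (0 : ℝ) 1, |distProb A ψ₀ θ₀ t θ - t ^ 2| ≤ C * ‖θ - θ₀‖ ^ 2) ∧
      ∀ t ∈ Set.Ioc (0 : ℝ) 1, 0 < distProb A ψ₀ θ₀ t θ ∧ ∀ i j : Fin M,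
        |qfim (distState A ψ₀ θ₀ t) θ i j - qfim (encState A ψ₀) θ i j / t ^ 2|
            ≤ C * ‖θ - θ₀‖ ^ 2 / t ^ 4 ∧
        |distProb A ψ₀ θ₀ t θ * qfim (distState A ψ₀ θ₀ t) θ i j - qfim (encState A ψ₀) θ i j|
            ≤ C * ‖θ - θ₀‖ ^ 2 / t ^ 2 := by
  obtain ⟨L, hL⟩ := exists_norm_encState_sub_le hA hψ₀ θ
  have hv : ‖encState A ψ₀ θ‖ = 1 := by rw [norm_encState hA, hψ₀]
  set x : Fin M → H := fun k => perp (encState A ψ₀ θ) (partialDeriv k (encState A ψ₀) θ) with hx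
  set D : ℝ := ∑ k, ‖x k‖ with hD_def
  have hD : ∀ k, ‖x k‖ ≤ D := fun k =>
    Finset.single_le_sum (f := fun k => ‖x k‖) (fun k _ => norm_nonneg _) (Finset.mem_univ k)
  have hL2 : ∀ θ₀, ‖encState A ψ₀ θ₀ - encState A ψ₀ θ‖ ^ 2 ≤ L ^ 2 * ‖θ - θ₀‖ ^ 2 := fun θ₀ => by
    rw [← mul_pow]
    exact pow_le_pow_left₀ (norm_nonneg _) (hL θ₀) 2
  -- `L²` controls `p - t²`. Replacing `1/p` by `1/t²` in the main term costs `4 D² L²`, and the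
  -- rank-one correction another `4 D² L²`.
  refine ⟨L ^ 2 + 8 * D ^ 2 * L ^ 2, fun θ₀ => ⟨fun t ht => ?_, fun t ht => ?_⟩⟩
  · rw [abs_of_nonneg (sub_nonneg.2 (sq_le_distProb hA hψ₀ θ₀ ht θ))]
    refine ((distProb_sub_sq_le hA hψ₀ θ₀ t θ).trans (hL2 θ₀)).trans ?_
    gcongr
    nlinarith [mul_nonneg (sq_nonneg D) (sq_nonneg L)]
  have ht' : t ∈ Set.Icc (0 : ℝ) 1 := ⟨ht.1.le, ht.2⟩
  have htp := sq_le_distProb hA hψ₀ θ₀ ht' θ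
  have ht0 : 0 < t := ht.1
  have ht2 : 0 < t ^ 2 := pow_pos ht0 2
  have hp := ht2.trans_le htp
  refine ⟨hp, fun i j => ?_⟩
  have hpt := (distProb_sub_sq_le hA hψ₀ θ₀ t θ).trans (hL2 θ₀)
  have hQ := abs_qfim_le hv hD i j
  have hr := (abs_re_inner_mul_inner_le (φ := encState A ψ₀ θ₀) (inner_perp_left hv _)
    (inner_perp_right hv _) (hD i) (hD j)).trans
      (mul_le_mul_of_nonneg_left (hL2 θ₀) (sq_nonneg D))
  rw [qfim_distState hA hψ₀ θ₀ ht]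
  set p := distProb A ψ₀ θ₀ t θ
  set Q := qfim (encState A ψ₀) θ i j
  set r := (inner ℂ (x i) (encState A ψ₀ θ₀) * inner ℂ (encState A ψ₀ θ₀) (x j)).re with hr_def
  set d := ‖θ - θ₀‖ ^ 2
  have hd : 0 ≤ d := sq_nonneg _
  have hq0 : 0 ≤ 1 - t ^ 2 := by nlinarith [ht'.1, ht'.2]
  have hq1 : |1 - t ^ 2| ≤ 1 := by rw [abs_of_nonneg hq0]; linarith
  have hX : 0 ≤ D ^ 2 * (L ^ 2 * d) := by positivity
  have hLd : 0 ≤ L ^ 2 * d := by positivity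
  have hqr : |4 * (1 - t ^ 2) * r| ≤ 4 * (D ^ 2 * (L ^ 2 * d)) := by
    rw [abs_mul, abs_mul, abs_of_pos (by norm_num : (0 : ℝ) < 4)]
    calc _ ≤ 4 * 1 * (D ^ 2 * (L ^ 2 * d)) := by gcongr
      _ = _ := by ring
  constructor
  · have e : Q / p - 4 * ((1 - t ^ 2) / p ^ 2) * r - Q / t ^ 2 =
        -(Q * (p - t ^ 2) / (p * t ^ 2) + 4 * (1 - t ^ 2) * r / p ^ 2) := by
      field_simp
      ring
    rw [e, abs_neg]
    have h1 : |Q * (p - t ^ 2) / (p * t ^ 2)| ≤ 4 * D ^ 2 * (L ^ 2 * d) / t ^ 4 := by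
      rw [abs_div, abs_mul, abs_of_nonneg (sub_nonneg.2 htp), abs_of_pos (mul_pos hp ht2)]
      have : t ^ 4 ≤ p * t ^ 2 := by nlinarith
      gcongr
    have h2 : |4 * (1 - t ^ 2) * r / p ^ 2| ≤ 4 * (D ^ 2 * (L ^ 2 * d)) / t ^ 4 := by
      rw [abs_div, abs_of_pos (pow_pos hp 2)]
      have : t ^ 4 ≤ p ^ 2 := by nlinarith
      gcongr
    refine (abs_add_le _ _).trans ((add_le_add h1 h2).trans ?_)
    rw [← add_div]
    gcongr
    nlinarith
  -- Multiplying by `p` cancels the main term exactly and leaves a single `1/p`, hence `t²` rather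
  -- than `t⁴`.
  · have e : p * (Q / p - 4 * ((1 - t ^ 2) / p ^ 2) * r) - Q = -(4 * (1 - t ^ 2) * r / p) := by
      field_simp
      ring
    rw [e, abs_neg, abs_div, abs_of_pos hp]
    gcongr
    nlinarith

/-! ### Matrix limits -/

/-- Positivity of the quadratic form persists nearby, uniformly on the compact unit sphere;
homogeneity extends it to all vectors. -/
lemma eventually_posSemidef {S₀ : Matrix (Fin M) (Fin M) ℝ} (h₀ : S₀.PosDef) :
    ∀ᶠ S in 𝓝 S₀, S.IsHermitian → S.PosSemidef := by
  have hc : Continuous fun z : Matrix (Fin M) (Fin M) ℝ × (Fin M → ℝ) =>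
      star z.2 ⬝ᵥ (z.1.mulVec z.2) := by fun_prop
  have h := (isCompact_sphere (0 : Fin M → ℝ) 1).eventually_forall_of_forall_eventually
    (x₀ := S₀) (P := fun S x => 0 < star x ⬝ᵥ (S.mulVec x)) fun x hx => by
      refine (hc.tendsto (S₀, x)).eventually_const_lt (h₀.dotProduct_mulVec_pos fun h0 => ?_)
      simp [show x = 0 from h0] at hx
  filter_upwards [h] with S hS hH
  refine .of_dotProduct_mulVec_nonneg hH fun x => ?_
  by_cases hx : x = 0
  · simp [hx]
  have hx' : ‖x‖ ≠ 0 := norm_ne_zero_iff.2 hx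
  have h1 := (hS (‖x‖⁻¹ • x) (by simp [norm_smul, hx'])).le
  have h2 : x = ‖x‖ • (‖x‖⁻¹ • x) := by rw [smul_smul, mul_inv_cancel₀ hx', one_smul]
  rw [h2]
  simp only [star_trivial] at h1 ⊢
  rw [Matrix.mulVec_smul, dotProduct_smul, smul_dotProduct]
  simp only [smul_eq_mul]
  positivity

lemma isHermitian_qfim {ψ : (Fin M → ℝ) → G} {θ : Fin M → ℝ} (h : ‖ψ θ‖ = 1) :
    (qfim ψ θ).IsHermitian := by
  ext i j
  rw [Matrix.conjTranspose_apply, qfim_apply_perp h, qfim_apply_perp h, star_trivial,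
    ← inner_conj_symm, Complex.conj_re]

lemma posSemidef_qfim {ψ : (Fin M → ℝ) → G} {θ : Fin M → ℝ} (h : ‖ψ θ‖ = 1) :
    (qfim ψ θ).PosSemidef := by
  let : InnerProductSpace ℝ G := InnerProductSpace.rclikeToReal ℂ G
  have h1 : qfim ψ θ =
      (4 : ℝ) • Matrix.gram ℝ fun i => perp (ψ θ) (partialDeriv i ψ θ) := by
    ext i j
    rw [qfim_apply_perp h]
    rfl
  rw [h1]
  exact (Matrix.posSemidef_gram ℝ _).smul (by norm_num)

/-- `(c Q)⁻¹ = p c⁻¹ (p Q)⁻¹`, where `(p Q)⁻¹` converges because the limit is nonsingular; so the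
risk is `O(p)`. -/
lemma tendsto_scalarRisk_zero {Q : ℕ → Matrix (Fin M) (Fin M) ℝ} {p : ℕ → ℝ}
    {Q₀ W : Matrix (Fin M) (Fin M) ℝ} (hp : Tendsto p atTop (𝓝 0)) (hp0 : ∀ᶠ n in atTop, 0 < p n)
    (hQ : Tendsto (fun n => p n • Q n) atTop (𝓝 Q₀)) (h₀ : Q₀.det ≠ 0) {c : ℝ} (hc : c ≠ 0)
    (N : ℕ) : Tendsto (fun n => scalarRisk N (c • Q n) W) atTop (𝓝 0) := by
  have hdet : Tendsto (fun n => (p n • Q n).det) atTop (𝓝 Q₀.det) :=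
    ((continuous_id.matrix_det).tendsto Q₀).comp hQ
  have hinv : Tendsto (fun n => (p n • Q n)⁻¹) atTop (𝓝 Q₀⁻¹) := by
    simp only [Matrix.inv_def, Ring.inverse_eq_inv']
    exact (hdet.inv₀ h₀).smul (((continuous_id.matrix_adjugate).tendsto Q₀).comp hQ)
  have htr : Tendsto (fun n => (W * (p n • Q n)⁻¹).trace) atTop (𝓝 (W * Q₀⁻¹).trace) :=
    (((continuous_const.matrix_mul continuous_id).matrix_trace).tendsto Q₀⁻¹).comp hinv
  have hlim : Tendsto (fun n => ENNReal.ofReal (p n * c⁻¹ * (W * (p n • Q n)⁻¹).trace / N)) atTop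
      (𝓝 0) := by
    have := ENNReal.tendsto_ofReal (((hp.mul_const c⁻¹).mul htr).div_const (N : ℝ))
    simpa using this
  refine hlim.congr' ?_
  filter_upwards [hp0, hdet.eventually_ne h₀] with n hn hd
  have hn' := hn.ne'
  rw [Matrix.det_smul] at hd
  have hQd : (Q n).det ≠ 0 := right_ne_zero_of_mul hd
  have h1 : (c • Q n).det ≠ 0 := by
    rw [Matrix.det_smul]; exact mul_ne_zero (pow_ne_zero _ hc) hQd
  rw [scalarRisk, if_neg h1]
  have : Invertible c := invertibleOfNonzero hc
  have : Invertible (p n) := invertibleOfNonzero hn'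
  rw [Matrix.inv_smul _ _ hQd.isUnit, Matrix.inv_smul _ _ hQd.isUnit]
  simp only [Matrix.mul_smul, Matrix.trace_smul, invOf_eq_inv, smul_eq_mul]
  congr 1
  field_simp

end QLearn

/-! ### Distillation bounds and the limit `t → 0⁺`. -/

theorem theorem2 {H : Type*} [NormedAddCommGroup H] [InnerProductSpace ℂ H] [CompleteSpace H]
    [FiniteDimensional ℂ H] (M : ℕ) (hM : 1 ≤ M)
    (A : Fin M → H →L[ℂ] H) (hA : ∀ m, IsSelfAdjoint (A m))
    (ψ₀ : H) (hψ₀ : ‖ψ₀‖ = 1) (θ : Fin M → ℝ) :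
    -- for all `0 ≤ t ≤ 1` the pair `{F, 1 - F}` with `F = K†K` is a measurement
    (∀ (θ₀ : Fin M → ℝ) (t : ℝ), t ∈ Set.Icc (0 : ℝ) 1 →
      (QLearn.postF (QLearn.distK A ψ₀ θ₀ t)).IsPositive ∧
      (1 - QLearn.postF (QLearn.distK A ψ₀ θ₀ t)).IsPositive) ∧
    -- success probability, postselected QFIM and losslessness, up to errors of order `δ²`
    (∃ C : ℝ, ∀ θ₀ : Fin M → ℝ,
      (∀ t ∈ Set.Icc (0 : ℝ) 1,
        |QLearn.distProb A ψ₀ θ₀ t θ - t ^ 2| ≤ C * ‖θ - θ₀‖ ^ 2) ∧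
      ∀ t ∈ Set.Ioc (0 : ℝ) 1,
        0 < QLearn.distProb A ψ₀ θ₀ t θ ∧
        ∀ i j : Fin M,
          |QLearn.qfim (QLearn.distState A ψ₀ θ₀ t) θ i j
              - QLearn.qfim (QLearn.encState A ψ₀) θ i j / t ^ 2|
            ≤ C * ‖θ - θ₀‖ ^ 2 / t ^ 4 ∧
          |QLearn.distProb A ψ₀ θ₀ t θ * QLearn.qfim (QLearn.distState A ψ₀ θ₀ t) θ i j
              - QLearn.qfim (QLearn.encState A ψ₀) θ i j|
            ≤ C * ‖θ - θ₀‖ ^ 2 / t ^ 2) ∧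
    -- the limit `M δ² ≪ t² → 0`
    (∀ (t : ℕ → ℝ) (θ₀ : ℕ → Fin M → ℝ), Tendsto t atTop (𝓝[>] 0) →
      Tendsto (fun n => (M : ℝ) * ‖θ - θ₀ n‖ ^ 2 / t n ^ 2) atTop (𝓝 0) →
      -- the distillation is lossless in the limit
      Tendsto (fun n => QLearn.distProb A ψ₀ (θ₀ n) (t n) θ
          • QLearn.qfim (QLearn.distState A ψ₀ (θ₀ n) (t n)) θ) atTop
        (𝓝 (QLearn.qfim (QLearn.encState A ψ₀) θ)) ∧
      -- every nonzero entry of the QFIM is amplified without bound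
      (∀ i j : Fin M, QLearn.qfim (QLearn.encState A ψ₀) θ i j ≠ 0 →
        Tendsto (fun n => |QLearn.qfim (QLearn.distState A ψ₀ (θ₀ n) (t n)) θ i j|)
          atTop atTop) ∧
      -- for a nonsingular QFIM the whole matrix diverges and the optimal risk vanishes
      ((QLearn.qfim (QLearn.encState A ψ₀) θ).det ≠ 0 →
        (∀ B : ℝ, ∀ᶠ n in atTop,
          (QLearn.qfim (QLearn.distState A ψ₀ (θ₀ n) (t n)) θ
            - B • (1 : Matrix (Fin M) (Fin M) ℝ)).PosSemidef) ∧
        Tendsto (fun n => (QLearn.qfim (QLearn.distState A ψ₀ (θ₀ n) (t n)) θ).det)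
          atTop atTop ∧
        ∀ (N : ℕ), 1 ≤ N → ∀ W : Matrix (Fin M) (Fin M) ℝ, W.PosSemidef →
          Tendsto (fun n => QLearn.riskMI N (QLearn.distState A ψ₀ (θ₀ n) (t n)) θ W)
            atTop (𝓝 0))) := by
  refine ⟨fun θ₀ t ht => ⟨QLearn.isPositive_postF _,
    QLearn.isPositive_one_sub_postF (QLearn.norm_distK_le hA hψ₀ θ₀ ht)⟩,
    QLearn.exists_distillation_bounds hA hψ₀ θ, fun t θ₀ ht hδ => ?_⟩
  obtain ⟨C, hC⟩ := QLearn.exists_distillation_bounds hA hψ₀ θ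
  set Q₀ := QLearn.qfim (QLearn.encState A ψ₀) θ with hQ₀
  set Q := fun n => QLearn.qfim (QLearn.distState A ψ₀ (θ₀ n) (t n)) θ with hQ
  set p := fun n => QLearn.distProb A ψ₀ (θ₀ n) (t n) θ with hp
  have ht0 : Tendsto t atTop (𝓝 0) := ht.mono_right nhdsWithin_le_nhds
  have htmem : ∀ᶠ n in atTop, t n ∈ Set.Ioc (0 : ℝ) 1 := by
    filter_upwards [ht.eventually self_mem_nhdsWithin, ht0.eventually (Iic_mem_nhds one_pos)]
      with n h1 h2 using ⟨h1, h2⟩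
  have hM' : (M : ℝ) ≠ 0 := by positivity
  have hδ' : Tendsto (fun n => C * ‖θ - θ₀ n‖ ^ 2 / t n ^ 2) atTop (𝓝 0) := by
    have := hδ.const_mul (C / M)
    rw [mul_zero] at this
    refine this.congr fun n => ?_
    field_simp
  have hp0 : ∀ᶠ n in atTop, 0 < p n := htmem.mono fun n h => ((hC (θ₀ n)).2 _ h).1
  have hplim : Tendsto p atTop (𝓝 0) := by
    -- The error `C δ²` is `(C δ² / t²) · t²`, a product of two null sequences.
    have h1 : Tendsto (fun n => p n - t n ^ 2) atTop (𝓝 0) := by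
      refine squeeze_zero_norm' (a := fun n => C * ‖θ - θ₀ n‖ ^ 2 / t n ^ 2 * t n ^ 2) ?_ ?_
      · filter_upwards [htmem] with n h
        rw [div_mul_cancel₀ _ (pow_ne_zero 2 h.1.ne')]
        exact (hC (θ₀ n)).1 _ ⟨h.1.le, h.2⟩
      · simpa using hδ'.mul (ht0.pow 2)
    simpa using h1.add (ht0.pow 2)
  have hpinv : Tendsto (fun n => (p n)⁻¹) atTop atTop :=
    tendsto_inv_nhdsGT_zero.comp (tendsto_nhdsWithin_iff.2 ⟨hplim, hp0⟩)
  have hlim : Tendsto (fun n => p n • Q n) atTop (𝓝 Q₀) := by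
    refine tendsto_pi_nhds.2 fun i => tendsto_pi_nhds.2 fun j => ?_
    refine tendsto_iff_norm_sub_tendsto_zero.2 (squeeze_zero' (.of_forall fun n => norm_nonneg _)
      ?_ hδ')
    filter_upwards [htmem] with n h
    exact (((hC (θ₀ n)).2 _ h).2 i j).2
  refine ⟨hlim, fun i j hij => ?_, fun hdet => ⟨fun B => ?_, ?_, fun N _ W _ => ?_⟩⟩
  · have h1 : Tendsto (fun n => |(p n • Q n) i j|) atTop (𝓝 |Q₀ i j|) :=
      ((tendsto_pi_nhds.1 (tendsto_pi_nhds.1 hlim i)) j).abs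
    refine (hpinv.atTop_mul_pos (abs_pos.2 hij) h1).congr' ?_
    filter_upwards [hp0] with n hn
    rw [Matrix.smul_apply, smul_eq_mul, abs_mul, abs_of_pos hn, inv_mul_cancel_left₀ hn.ne']
  · have hpd : Q₀.PosDef := (QLearn.posSemidef_qfim
      (by rw [QLearn.norm_encState hA, hψ₀])).posDef_iff_det_ne_zero.2 hdet
    -- As `p → 0`, the shift `p B` disappears in the limit for every `B`; positivity is then
    -- rescaled by `1/p`.
    have h1 : Tendsto (fun n => p n • Q n - (p n * B) • (1 : Matrix (Fin M) (Fin M) ℝ)) atTop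
        (𝓝 Q₀) := by
      simpa using hlim.sub ((hplim.mul_const B).smul_const (1 : Matrix (Fin M) (Fin M) ℝ))
    filter_upwards [h1.eventually (QLearn.eventually_posSemidef hpd), hp0, htmem] with n h2 hn hm
    have hH : (Q n).IsHermitian :=
      QLearn.isHermitian_qfim (QLearn.norm_distState hA hψ₀ (θ₀ n) hm θ)
    have h3 := (h2 ((hH.smul (IsSelfAdjoint.all _)).sub
      (Matrix.isHermitian_one.smul (IsSelfAdjoint.all _)))).smul (inv_pos.2 hn).le
    rwa [smul_sub, smul_smul, smul_smul, inv_mul_cancel_left₀ hn.ne', inv_mul_cancel₀ hn.ne',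
      one_smul] at h3
  · have hpd : Q₀.PosDef := (QLearn.posSemidef_qfim
      (by rw [QLearn.norm_encState hA, hψ₀])).posDef_iff_det_ne_zero.2 hdet
    have h1 : Tendsto (fun n => (p n • Q n).det) atTop (𝓝 Q₀.det) :=
      ((continuous_id.matrix_det).tendsto Q₀).comp hlim
    -- `det Q = p⁻ᴹ det (p Q)`, with `M ≥ 1` making the first factor diverge.
    refine (((tendsto_pow_atTop (by omega : M ≠ 0)).comp hpinv).atTop_mul_pos hpd.det_pos
      h1).congr' ?_
    filter_upwards [hp0] with n hn
    rw [Matrix.det_smul, Fintype.card_fin, Function.comp_apply, ← mul_assoc, ← mul_pow,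
      inv_mul_cancel₀ hn.ne', one_pow, one_mul]
  · have : Nontrivial H := nontrivial_of_ne ψ₀ 0 fun h => by simp [h] at hψ₀
    have : FiniteDimensional ℝ H := FiniteDimensional.complexToReal H
    have hd : (Module.finrank ℝ H : ℝ) ≠ 0 := Nat.cast_ne_zero.2 Module.finrank_pos.ne'
    refine tendsto_of_tendsto_of_tendsto_of_le_of_le' tendsto_const_nhds
      (QLearn.tendsto_scalarRisk_zero (W := W) hplim hp0 hlim hdet
        (c := (4 * Module.finrank ℝ H : ℝ)⁻¹) (by positivity) N)
      (.of_forall fun n => zero_le) ?_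
    filter_upwards [htmem] with n h
    exact QLearn.riskMI_le (QLearn.norm_distState hA hψ₀ (θ₀ n) h)
      (QLearn.differentiable_distState hA hψ₀ (θ₀ n) h θ) N W
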